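/- Let $X=\{a,b\}$ be a binary alphabet with $a$ the first and $b$ the second letter, and let $X^*$ be the free monoid on $X$. A morphism $h:X^*\to X^*$ is upper triangular if its matrix, whose entry in row $x$ and column $y$ is the number of occurrences of the letter $x$ in $h(y)$, is upper triangular. Let $g_1,g_2:X^*\to X^*$ be the upper triangular morphisms given by $$g_1(a)=a^s,\qquad g_1(b)=a^{\gamma_1}ba^{\alpha_1}ba^{\alpha_2}b\cdots ba^{\alpha_{p-1}}ba^{\gamma_2},$$ $$g_2(a)=a^t,\qquad g_2(b)=a^{\delta_1}ba^{\beta_1}ba^{\beta_2}b\cdots ba^{\beta_{q-1}}ba^{\delta_2},$$ where $s,t\ge 1$, $p,q\ge 2$ and $\gamma_1,\gamma_2,\delta_1,\delta_2,\alpha_1,\ldots,\alpha_{p-1},\beta_1,\ldots,\beta_{q-1}\ge 0$ are integers. (These are exactly the upper triangular morphisms with nonsingular matrix for which $g_1(b)$ and $g_2(b)$ contain $p\ge 2$ and $q\ge 2$ occurrences of $b$, respectively.) Assume that $p$ and $q$ are multiplicatively independent, that is, there are no positive integers $r,m,n$ with $p=r^m$ and $q=r^n$. Then $g_1g_2=g_2g_1$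 (equality of compositions) if and only if at least one of the following conditions holds: (i) $g_1(b)\in b^*$ and $g_2(b)\in b^*$, where $b^*=\{b^n : n\ge 0\}$; (ii) $g_1(a)=g_2(a)=a$, $g_1(b)=(ba^{\alpha})^{p-1}b$ and $g_2(b)=(ba^{\alpha})^{q-1}b$, where $\alpha=\alpha_1$. -/

import Mathlib

namespace BinaryMorphism

/-- Endomorphisms of the free monoid `X^*`; the product `g * h` is the composition `g ∘ h`. -/
abbrev EndWord (X : Type) : Type := Monoid.End (FreeMonoid X)

/-- The number `|w|_x` of occurrences of the letter `x` in the word `w`. -/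
def occ {X : Type} [DecidableEq X] (x : X) (w : FreeMonoid X) : ℕ :=
  (FreeMonoid.toList w).count x

/-- The matrix of a morphism: the entry in row `x` and column `y` is `|h(y)|_x`. -/
def morphismMatrix {X : Type} [DecidableEq X] (h : EndWord X) : Matrix X X ℕ :=
  fun x y => occ x (h (FreeMonoid.of y))

/-- The set `Tri(X^*)` of upper triangular morphisms. -/
def Tri (X : Type) [LinearOrder X] : Set (EndWord X) :=
  {h | (morphismMatrix h).BlockTriangular id}

/-- The letter `a`, the first letter of the binary alphabet, as a word. -/
def a : FreeMonoid (Fin 2) := FreeMonoid.of 0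

/-- The letter `b`, the second letter of the binary alphabet, as a word. -/
def b : FreeMonoid (Fin 2) := FreeMonoid.of 1

/-- The word `a^{γ₁} b a^{α 1} b a^{α 2} b ⋯ b a^{α (p-1)} b a^{γ₂}` (for `p ≥ 1`),
which has `p` occurrences of `b`. Only the values `α 1, …, α (p-1)` matter. -/
def blockWord (p γ₁ γ₂ : ℕ) (α : ℕ → ℕ) : FreeMonoid (Fin 2) :=
  a ^ γ₁ * b * ((List.range' 1 (p - 1)).map (fun i => a ^ α i * b)).prod * a ^ γ₂

/-- `p` and `q` are positive powers of a common positive integer. -/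
def MultDependent (p q : ℕ) : Prop :=
  ∃ r m n : ℕ, 0 < r ∧ 0 < m ∧ 0 < n ∧ p = r ^ m ∧ q = r ^ n

/-- Multiplicative independence. -/
def MultIndependent (p q : ℕ) : Prop := ¬ MultDependent p q

end BinaryMorphism

namespace BinaryMorphism

/-! Encode a word by its gaps, the exponents of `a` between consecutive `b`s. Each morphism acts on
gap sequences by `gapMap` (`map_blockWord`), and commuting morphisms have commuting gap maps. Hence
the unique fixed sequence of the first map is fixed by the second (`exponents_of_comm`). A sequence
self-similar at scales `p` and `q` with incomparable powers is constant, by the Chinese remainder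
theorem (`apply_eq_apply_one`). Its value `c` satisfies `γ₁ + γ₂ + s * c = c` and the analogue for
`g₂`, so the outer exponents vanish and either `c = 0` or `s = t = 1`. -/

/-! ### Arithmetic: incomparable powers -/

/-- Multiplicatively independent integers have powers neither of which divides the other. -/
theorem MultIndependent.exists_pow_not_dvd_pow {p q : ℕ} (hp : 2 ≤ p) (hq : 2 ≤ q)
    (h : MultIndependent p q) :
    ∃ k l : ℕ, ¬ p ^ k ∣ q ^ l ∧ ¬ q ^ l ∣ p ^ k := by
  by_contra! hc
  have key : ∀ N p q : ℕ, p + q ≤ N → 2 ≤ p → 2 ≤ q →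
      (∀ k l : ℕ, ¬ p ^ k ∣ q ^ l → q ^ l ∣ p ^ k) → MultDependent p q := by
    intro N
    induction N with
    | zero => intros; omega
    | succ N ih =>
      -- Euclidean descent: if `q = p * c`, cancelling `p ^ l` passes comparability of all powers to
      -- the pair `p`, `c`, whose sum is smaller.
      have main : ∀ p q : ℕ, p + q ≤ N + 1 → 2 ≤ p → 2 ≤ q → p ∣ q →
          (∀ k l : ℕ, ¬ p ^ k ∣ q ^ l → q ^ l ∣ p ^ k) → MultDependent p q := by
        rintro p _ hN hp hq ⟨c, rfl⟩ hc
        have hc0 : c ≠ 0 := by rintro rfl; omega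
        obtain rfl | hc2 : c = 1 ∨ 2 ≤ c := by omega
        · exact ⟨p, 1, 1, by omega, one_pos, one_pos, by simp, by simp⟩
        have hlt : c + p ≤ p * c := by nlinarith
        obtain ⟨r, m, n, hr, hm, hn, h₁, h₂⟩ := ih p c (by omega) hp hc2 fun k l hkl => by
          have := hc (k + l) l
          rw [mul_pow, pow_add, mul_comm (p ^ k)] at this
          have hpl : 0 < p ^ l := by positivity
          rw [Nat.mul_dvd_mul_iff_left hpl, Nat.mul_dvd_mul_iff_left hpl] at this
          exact this hkl
        exact ⟨r, m, m + n, hr, hm, by omega, h₁, by rw [pow_add, ← h₁, ← h₂]⟩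
      intro p q hN hp hq hc
      by_cases hd : p ∣ q
      · exact main p q hN hp hq hd hc
      · have hd' : q ∣ p := by simpa using hc 1 1 (by simpa using hd)
        obtain ⟨r, m, n, hr, hm, hn, h₁, h₂⟩ := main q p (by omega) hq hp hd' fun k l hkl => by
          by_contra h
          exact hkl (hc l k h)
        exact ⟨r, n, m, hr, hn, hm, h₂, h₁⟩
  exact h (key _ p q le_rfl hp hq hc)

/-! ### Self-similar sequences -/

/-- The sequence of exponents of `a` between consecutive `b`s in the image of a word whose sequence
is `F`, under the morphism `a ↦ a ^ s`, `b ↦ blockWord p γ₁ γ₂ α` with `γ = γ₁ + γ₂`. -/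
def gapMap (p s γ : ℕ) (α F : ℕ → ℕ) (n : ℕ) : ℕ :=
  if p ∣ n then γ + s * F (n / p) else α (n % p)

/-- The fixed point of `gapMap p s γ α` on the positive integers. -/
def gapFix (p s γ : ℕ) (α : ℕ → ℕ) (n : ℕ) : ℕ :=
  if h : p ∣ n ∧ 2 ≤ p ∧ 0 < n then γ + s * gapFix p s γ α (n / p) else α (n % p)
termination_by n
decreasing_by exact Nat.div_lt_self h.2.2 h.2.1

theorem gapMap_gapFix {p : ℕ} (hp : 2 ≤ p) (s γ : ℕ) (α : ℕ → ℕ) {n : ℕ} (hn : 0 < n) :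
    gapMap p s γ α (gapFix p s γ α) n = gapFix p s γ α n := by
  conv_rhs => rw [gapFix]
  by_cases h : p ∣ n <;> simp [gapMap, h, hp, hn]

theorem eq_gapFix {p : ℕ} (hp : 2 ≤ p) {s γ : ℕ} {α H : ℕ → ℕ}
    (hH : ∀ n, 0 < n → gapMap p s γ α H n = H n) {n : ℕ} (hn : 0 < n) :
    H n = gapFix p s γ α n := by
  induction n using Nat.strong_induction_on with
  | _ n ih =>
    rw [← hH n hn, ← gapMap_gapFix hp s γ α hn]
    by_cases h : p ∣ n
    · simp only [gapMap, h, if_true]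
      rw [ih _ (Nat.div_lt_self hn hp) (Nat.div_pos (Nat.le_of_dvd hn h) (by omega))]
    · simp [gapMap, h]

/-- Off the multiples of `p * q` the composite never reads `F`. -/
theorem gapMap_comp {p q s t γ δ : ℕ} {α β : ℕ → ℕ} (F : ℕ → ℕ) {n : ℕ}
    (hn : ¬ p * q ∣ n) :
    gapMap p s γ α (gapMap q t δ β F) n = gapMap p s γ α β (n % (p * q)) := by
  have hdvd : p ∣ n % (p * q) ↔ p ∣ n := Nat.dvd_mod_iff (Dvd.intro _ rfl)
  by_cases h : p ∣ n
  · have hq : ¬ q ∣ n / p := fun hq => hn (Nat.mul_dvd_of_dvd_div h hq)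
    simp [gapMap, h, hdvd, hq, Nat.mod_mul_right_div_self]
  · simp [gapMap, h, hdvd]

theorem gapMap_comm {p q s t γ δ : ℕ} {α β : ℕ → ℕ} (hp : 2 ≤ p) (hq : 2 ≤ q)
    (hγδ : γ + s * δ = δ + t * γ)
    (h : ∀ n, 0 < n → n < p * q → gapMap p s γ α β n = gapMap q t δ β α n) (F : ℕ → ℕ) (n : ℕ) :
    gapMap p s γ α (gapMap q t δ β F) n = gapMap q t δ β (gapMap p s γ α F) n := by
  by_cases hn : p * q ∣ n
  · obtain ⟨m, rfl⟩ := hn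
    have h₁ : p * q * m / p = q * m := by
      rw [mul_assoc, Nat.mul_div_cancel_left _ (by omega)]
    have h₂ : p * q * m / q = p * m := by
      rw [mul_comm p q, mul_assoc, Nat.mul_div_cancel_left _ (by omega)]
    have h₃ : p ∣ p * q * m := ⟨q * m, by ring⟩
    have h₄ : q ∣ p * q * m := ⟨p * m, by ring⟩
    simp only [gapMap, h₁, h₂, h₃, h₄, if_true, dvd_mul_right,
      Nat.mul_div_cancel_left m (show 0 < p by omega),
      Nat.mul_div_cancel_left m (show 0 < q by omega)]
    linear_combination hγδ
  · rw [gapMap_comp F hn, gapMap_comp F (by rwa [mul_comm]), mul_comm q p]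
    exact h _ (Nat.pos_of_ne_zero fun h0 => hn (Nat.dvd_of_mod_eq_zero h0))
      (Nat.mod_lt _ (by positivity))

section Fixed

variable {p s γ : ℕ} {α G : ℕ → ℕ}

/-- Factors of `p` are peeled off until the last nonzero base-`p` digit selects a value of `α`; both
are visible modulo `p ^ k`. -/
theorem apply_eq_of_modEq_pow (hp : 2 ≤ p)
    (hG : ∀ n, 0 < n → gapMap p s γ α G n = G n) (k : ℕ) {m n : ℕ}
    (hmn : m ≡ n [MOD p ^ k]) (hm : ¬ p ^ k ∣ m) : G m = G n := by
  induction k generalizing m n with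
  | zero => simp at hm
  | succ k ih =>
    have hn : ¬ p ^ (k + 1) ∣ n := fun h => hm ((hmn.dvd_iff dvd_rfl).2 h)
    have hm0 : 0 < m := Nat.pos_of_ne_zero (by rintro rfl; simp at hm)
    have hn0 : 0 < n := Nat.pos_of_ne_zero (by rintro rfl; simp at hn)
    have hmod : m ≡ n [MOD p] := hmn.of_dvd (dvd_pow_self p k.succ_ne_zero)
    rw [← hG m hm0, ← hG n hn0]
    by_cases h : p ∣ m
    · have h' : p ∣ n := (hmod.dvd_iff dvd_rfl).1 h
      obtain ⟨m, rfl⟩ := h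
      obtain ⟨n, rfl⟩ := h'
      have hp0 : 0 < p := by omega
      rw [pow_succ', Nat.mul_dvd_mul_iff_left hp0] at hm
      rw [pow_succ'] at hmn
      simp only [gapMap, dvd_mul_right, if_true, Nat.mul_div_cancel_left _ hp0]
      rw [ih (Nat.ModEq.mul_left_cancel' hp0.ne' hmn) hm]
    · have h' : ¬ p ∣ n := fun h' => h ((hmod.dvd_iff dvd_rfl).2 h')
      simp only [gapMap, h, h', if_false]
      rw [hmod]

theorem apply_inj_of_apply_pow_mul (hp : 2 ≤ p) (hs : 1 ≤ s)
    (hG : ∀ n, 0 < n → gapMap p s γ α G n = G n) (k : ℕ) {m n : ℕ} (hm : 0 < m) (hn : 0 < n)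
    (h : G (p ^ k * m) = G (p ^ k * n)) : G m = G n := by
  induction k with
  | zero => simpa using h
  | succ k ih =>
    have hp0 : 0 < p := by omega
    rw [pow_succ', mul_assoc, mul_assoc, ← hG _ (by positivity),
      ← hG (p * (p ^ k * n)) (by positivity)] at h
    simp only [gapMap, dvd_mul_right, if_true, Nat.mul_div_cancel_left _ hp0] at h
    exact ih (Nat.eq_of_mul_eq_mul_left hs (Nat.add_left_cancel h))

/-- A sequence self-similar for two scales with incomparable powers is constant. -/
theorem apply_eq_apply_one {q t δ : ℕ} {β : ℕ → ℕ} (hp : 2 ≤ p) (hq : 2 ≤ q) (hs : 1 ≤ s)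
    (hG₁ : ∀ n, 0 < n → gapMap p s γ α G n = G n)
    (hG₂ : ∀ n, 0 < n → gapMap q t δ β G n = G n) {k l : ℕ}
    (hkl : ¬ p ^ k ∣ q ^ l) (hlk : ¬ q ^ l ∣ p ^ k) {m : ℕ} (hm : 0 < m) : G m = G 1 := by
  -- Exponents are scaled by `m` so that `q ^ (l * m)` cannot divide `p ^ (k * m) * n` for `0 < n ≤
  -- m`.
  have hm1 : m ≠ 0 := hm.ne'
  have hk : ¬ p ^ (k * m) ∣ q ^ (l * m) := by
    rwa [pow_mul, pow_mul, Nat.pow_dvd_pow_iff hm1]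
  have hq0 : 0 < q ^ l := by positivity
  set d := Nat.gcd (p ^ (k * m)) (q ^ (l * m)) with hd
  have hdp : ¬ p ^ (k * m) ∣ d := fun h => hk (h.trans (Nat.gcd_dvd_right _ _))
  -- Some `x` is congruent to `p ^ (k * m) * n` modulo `q ^ (l * m)` and to `d` modulo `p ^ (k *
  -- m)`; `G x` is read off at both scales.
  have base : ∀ n, ¬ q ^ (l * m) ∣ p ^ (k * m) * n → G (p ^ (k * m) * n) = G d := by
    intro n hn
    have hmod : p ^ (k * m) * n ≡ d [MOD Nat.gcd (q ^ (l * m)) (p ^ (k * m))] := by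
      rw [Nat.gcd_comm, ← hd]
      exact ((Nat.modEq_zero_iff_dvd).2 ((Nat.gcd_dvd_left _ _).mul_right n)).trans
        ((Nat.modEq_zero_iff_dvd).2 dvd_rfl).symm
    obtain ⟨x, hx₁, hx₂⟩ := Nat.chineseRemainder' hmod
    exact (apply_eq_of_modEq_pow hq hG₂ _ hx₁.symm hn).trans
      (apply_eq_of_modEq_pow hp hG₁ _ hx₂.symm hdp).symm
  -- `e = q ^ l / gcd (p ^ k) (q ^ l)` exceeds `1`, so `e ^ m` does not divide `m`.
  have hndvd : ∀ n, 0 < n → n ≤ m → ¬ q ^ (l * m) ∣ p ^ (k * m) * n := by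
    intro n hn hnm h
    obtain ⟨e', e, hcop, h₁, h₂⟩ := Nat.exists_coprime (p ^ k) (q ^ l)
    have hd0 : 0 < (p ^ k).gcd (q ^ l) := Nat.gcd_pos_of_pos_right _ hq0
    have he : 1 < e := by
      by_contra! hle
      interval_cases e
      · omega
      · exact hlk (by rw [h₂, one_mul]; exact Nat.gcd_dvd_left _ _)
    have hdvd : e ^ m ∣ e' ^ m * n := by
      rw [pow_mul, pow_mul] at h
      generalize (p ^ k).gcd (q ^ l) = g at *
      rw [h₁, h₂, mul_pow, mul_pow, mul_right_comm] at h
      exact Nat.dvd_of_mul_dvd_mul_right (by positivity) h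
    have hlt : m < e ^ m := Nat.lt_pow_self he
    exact absurd (Nat.le_of_dvd hn ((hcop.symm.pow m m).dvd_of_dvd_mul_left hdvd)) (by omega)
  refine apply_inj_of_apply_pow_mul hp hs hG₁ (k * m) hm one_pos ?_
  rw [base m (hndvd m hm le_rfl), base 1 (hndvd 1 one_pos hm)]

end Fixed

/-! ### Block words -/

theorem mul_b_mul_a_pow_inj {u v : FreeMonoid (Fin 2)} {x y : ℕ}
    (h : u * b * a ^ x = v * b * a ^ y) : u = v ∧ x = y := by
  have snoc : ∀ {u v : FreeMonoid (Fin 2)} {c d : Fin 2},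
      u * FreeMonoid.of c = v * FreeMonoid.of d → u = v ∧ c = d := by
    intro u v c d h
    have := List.append_inj' (congrArg FreeMonoid.toList h) rfl
    exact ⟨this.1, by simpa using this.2⟩
  induction x generalizing y with
  | zero =>
    cases y with
    | zero => simpa using h
    | succ y =>
      rw [pow_zero, mul_one, pow_succ, ← mul_assoc] at h
      exact absurd (snoc h).2 (by decide)
  | succ x ih =>
    cases y with
    | zero =>
      rw [pow_zero, mul_one, pow_succ, ← mul_assoc] at h
      exact absurd (snoc h).2 (by decide)
    | succ y =>
      rw [pow_succ, ← mul_assoc, pow_succ, ← mul_assoc] at h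
      obtain ⟨h₁, rfl⟩ := ih (snoc h).1
      exact ⟨h₁, rfl⟩

theorem a_pow_injective : Function.Injective (a ^ · : ℕ → FreeMonoid (Fin 2)) := by
  intro x y h
  refine (mul_b_mul_a_pow_inj (u := 1) (v := 1) ?_).2
  simp only at h
  rw [h]

theorem blockWord_one (x y : ℕ) (F : ℕ → ℕ) : blockWord 1 x y F = a ^ x * b * a ^ y := by
  simp [blockWord]

theorem blockWord_succ {n : ℕ} (hn : 1 ≤ n) (x y : ℕ) (F : ℕ → ℕ) :
    blockWord (n + 1) x y F = blockWord n x (F n) F * b * a ^ y := by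
  obtain ⟨n, rfl⟩ := Nat.exists_eq_add_of_le' hn
  simp [blockWord, List.range'_1_concat, mul_assoc, add_comm]

theorem blockWord_mul_a_pow (n x y z : ℕ) (F : ℕ → ℕ) :
    blockWord n x y F * a ^ z = blockWord n x (y + z) F := by
  simp [blockWord, pow_add, mul_assoc]

theorem blockWord_congr (n x y : ℕ) {F F' : ℕ → ℕ} (h : ∀ i, 0 < i → i < n → F i = F' i) :
    blockWord n x y F = blockWord n x y F' := by
  unfold blockWord
  congr 3
  refine List.map_congr_left fun i hi => ?_
  rw [List.mem_range'_1] at hi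
  rw [h i (by omega) (by omega)]

theorem blockWord_inj {n : ℕ} (hn : 1 ≤ n) {x y x' y' : ℕ} {F F' : ℕ → ℕ}
    (h : blockWord n x y F = blockWord n x' y' F') :
    x = x' ∧ y = y' ∧ ∀ i, 0 < i → i < n → F i = F' i := by
  induction n, hn using Nat.le_induction generalizing y y' with
  | base =>
    rw [blockWord_one, blockWord_one] at h
    obtain ⟨h₁, h₂⟩ := mul_b_mul_a_pow_inj h
    exact ⟨a_pow_injective h₁, h₂, fun i _ _ => by omega⟩
  | succ n hn ih =>
    rw [blockWord_succ hn, blockWord_succ hn] at h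
    obtain ⟨h₁, h₂⟩ := mul_b_mul_a_pow_inj h
    obtain ⟨h₃, h₄, h₅⟩ := ih h₁
    refine ⟨h₃, h₂, fun i hi hin => ?_⟩
    obtain rfl | hlt : i = n ∨ i < n := by omega
    · exact h₄
    · exact h₅ i hi hlt

theorem blockWord_mul_blockWord {m k : ℕ} (hm : 1 ≤ m) (hk : 1 ≤ k) {x y γ₁ z : ℕ} {F α : ℕ → ℕ}
    (hF : F m = y + γ₁) (hα : ∀ i, 0 < i → i < k → F (m + i) = α i) :
    blockWord m x y F * blockWord k γ₁ z α = blockWord (m + k) x z F := by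
  induction k, hk using Nat.le_induction generalizing z with
  | base =>
    rw [blockWord_one, blockWord_succ hm, hF, ← blockWord_mul_a_pow]
    simp only [mul_assoc]
  | succ k hk ih =>
    rw [blockWord_succ hk, ← mul_assoc, ← mul_assoc, ih fun i hi hik => hα i hi (by omega),
      ← add_assoc, blockWord_succ (by omega), hα k hk (by omega)]

/-- Gaps at non-multiples of `p` lie inside one copy of `g b`; the others are junctions, where `γ₂`,
the stretched gap and `γ₁` fuse. -/
theorem map_blockWord {g : EndWord (Fin 2)} {p s γ₁ γ₂ : ℕ} {α : ℕ → ℕ} (hp : 1 ≤ p)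
    (ha : g a = a ^ s) (hb : g b = blockWord p γ₁ γ₂ α) {n : ℕ} (hn : 1 ≤ n)
    (x y : ℕ) (F : ℕ → ℕ) :
    g (blockWord n x y F) =
      blockWord (p * n) (γ₁ + s * x) (γ₂ + s * y) (gapMap p s (γ₁ + γ₂) α F) := by
  have hlow : ∀ n i, 0 < i → i < p → gapMap p s (γ₁ + γ₂) α F (p * n + i) = α i := by
    intro n i hi hip
    have : ¬ p ∣ p * n + i := by
      rw [Nat.dvd_add_right (dvd_mul_right p n)]
      exact Nat.not_dvd_of_pos_of_lt hi hip
    simp [gapMap, this, Nat.mod_eq_of_lt hip]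
  induction n, hn using Nat.le_induction generalizing y with
  | base =>
    rw [blockWord_one, map_mul, map_mul, map_pow, map_pow, ha, hb, mul_one, mul_assoc,
      ← pow_mul, ← pow_mul, blockWord_mul_a_pow]
    rw [blockWord_congr p (γ₁ + s * x) _ fun i hi hip => by simpa using hlow 0 i hi hip]
    simp only [blockWord, pow_add, ← mul_assoc]
    rw [← pow_add, ← pow_add, add_comm]
  | succ n hn ih =>
    have hgn : gapMap p s (γ₁ + γ₂) α F (p * n) = γ₂ + s * F n + γ₁ := by
      simp only [gapMap, dvd_mul_right, if_true, Nat.mul_div_cancel_left _ (show 0 < p from hp)]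
      ring
    rw [blockWord_succ hn, map_mul, map_mul, ih, hb, map_pow, ha, ← pow_mul, mul_assoc,
      blockWord_mul_a_pow, blockWord_mul_blockWord (by nlinarith) hp hgn (hlow n), mul_add,
      mul_one]

theorem blockWord_zero_zero_of_const {p c : ℕ} (hp : 1 ≤ p) {F : ℕ → ℕ}
    (h : ∀ i, 0 < i → i < p → F i = c) : blockWord p 0 0 F = (b * a ^ c) ^ (p - 1) * b := by
  rw [blockWord_congr p 0 0 h]
  obtain ⟨p, rfl⟩ := Nat.exists_eq_add_of_le' hp
  have : ∀ n, b * (a ^ c * b) ^ n = (b * a ^ c) ^ n * b := fun n => by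
    induction n with
    | zero => simp
    | succ n ih => rw [pow_succ, ← mul_assoc, ih, pow_succ]; simp only [mul_assoc]
  simp [blockWord, this]

/-! ### Commuting morphisms -/

theorem hom_ext {g h : EndWord (Fin 2)} (ha : g a = h a) (hb : g b = h b) : g = h := by
  refine FreeMonoid.hom_eq fun x => ?_
  fin_cases x
  · exact ha
  · exact hb

/-- Commuting block morphisms with multiplicatively independent `p` and `q` have all their exponents
equal. -/
theorem exponents_of_comm {g₁ g₂ : EndWord (Fin 2)} {s t p q γ₁ γ₂ δ₁ δ₂ : ℕ} {α β : ℕ → ℕ}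
    (hs : 1 ≤ s) (hp : 2 ≤ p) (hq : 2 ≤ q)
    (hg₁a : g₁ a = a ^ s) (hg₁b : g₁ b = blockWord p γ₁ γ₂ α)
    (hg₂a : g₂ a = a ^ t) (hg₂b : g₂ b = blockWord q δ₁ δ₂ β)
    (hpq : MultIndependent p q) (hcomm : g₁ * g₂ = g₂ * g₁) :
    ∃ c, γ₁ + γ₂ + s * c = c ∧ δ₁ + δ₂ + t * c = c ∧
      (∀ i, 0 < i → i < p → α i = c) ∧ ∀ i, 0 < i → i < q → β i = c := by
  have h : g₁ (g₂ b) = g₂ (g₁ b) := DFunLike.congr_fun hcomm b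
  rw [hg₁b, hg₂b, map_blockWord (by omega) hg₁a hg₁b (by omega),
    map_blockWord (by omega) hg₂a hg₂b (by omega), mul_comm q p] at h
  obtain ⟨h₁, h₂, h₃⟩ := blockWord_inj (Nat.mul_pos (by omega) (by omega)) h
  have hT := gapMap_comm hp hq (by linear_combination h₁ + h₂) h₃
  set G := gapFix p s (γ₁ + γ₂) α with hGdef
  have hG₁ : ∀ n, 0 < n → gapMap p s (γ₁ + γ₂) α G n = G n := fun n => gapMap_gapFix hp _ _ _
  have hG₂ : ∀ n, 0 < n → gapMap q t (δ₁ + δ₂) β G n = G n := fun n => by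
    -- By commutation `gapMap q` sends `G` to another fixed point of `gapMap p`; uniqueness
    -- identifies the two.
    refine eq_gapFix hp fun n hn => ?_
    rw [hT]
    by_cases hqn : q ∣ n
    · simp only [gapMap, hqn, if_true]
      -- `G` is known to be fixed only at positive indices, hence the check that `n / q` is
      -- positive.
      rw [← hG₁ (n / q) (Nat.div_pos (Nat.le_of_dvd hn hqn) (by omega))]
      rfl
    · simp [gapMap, hqn]
  obtain ⟨k, l, hkl, hlk⟩ := hpq.exists_pow_not_dvd_pow hp hq
  have hc : ∀ n, 0 < n → G n = G 1 := fun n hn =>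
    apply_eq_apply_one hp hq hs hG₁ hG₂ hkl hlk hn
  have hp0 : 0 < p := by omega
  have hq0 : 0 < q := by omega
  refine ⟨G 1, ?_, ?_, fun i hi hip => ?_, fun i hi hiq => ?_⟩
  · have := hG₁ p hp0
    rwa [hc p hp0, gapMap, if_pos dvd_rfl, Nat.div_self hp0] at this
  · have := hG₂ q hq0
    rwa [hc q hq0, gapMap, if_pos dvd_rfl, Nat.div_self hq0] at this
  · have := hG₁ i hi
    rwa [hc i hi, gapMap, if_neg (Nat.not_dvd_of_pos_of_lt hi hip), Nat.mod_eq_of_lt hip] at this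
  · have := hG₂ i hi
    rwa [hc i hi, gapMap, if_neg (Nat.not_dvd_of_pos_of_lt hi hiq), Nat.mod_eq_of_lt hiq] at this

theorem comm_of_powers {g₁ g₂ : EndWord (Fin 2)} {s t : ℕ} (hg₁a : g₁ a = a ^ s)
    (hg₂a : g₂ a = a ^ t) (h₁ : g₁ b ∈ Submonoid.powers b) (h₂ : g₂ b ∈ Submonoid.powers b) :
    g₁ * g₂ = g₂ * g₁ := by
  obtain ⟨m, hm⟩ := h₁
  obtain ⟨n, hn⟩ := h₂
  refine hom_ext ?_ ?_
  · change g₁ (g₂ a) = g₂ (g₁ a)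
    rw [hg₁a, hg₂a, map_pow, map_pow, hg₁a, hg₂a, ← pow_mul, ← pow_mul, mul_comm]
  · change g₁ (g₂ b) = g₂ (g₁ b)
    rw [← hm, ← hn]
    simp only [map_pow]
    rw [← hm, ← hn]
    simp only [← pow_mul]
    rw [mul_comm]

/-- Both morphisms send `b * a ^ c` to a power of itself, so they commute on it; `a ^ c` is fixed
and cancels. -/
theorem comm_of_periodic {g₁ g₂ : EndWord (Fin 2)} {p q c : ℕ} (hp : 1 ≤ p) (hq : 1 ≤ q)
    (h₁a : g₁ a = a) (h₂a : g₂ a = a) (h₁b : g₁ b = (b * a ^ c) ^ (p - 1) * b)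
    (h₂b : g₂ b = (b * a ^ c) ^ (q - 1) * b) : g₁ * g₂ = g₂ * g₁ := by
  have hu : ∀ {g : EndWord (Fin 2)} {n : ℕ}, 1 ≤ n → g a = a →
      g b = (b * a ^ c) ^ (n - 1) * b → g (b * a ^ c) = (b * a ^ c) ^ n := by
    intro g n hn ha hb
    obtain ⟨n, rfl⟩ := Nat.exists_eq_add_of_le' hn
    rw [map_mul, map_pow, ha, hb, mul_assoc, Nat.add_sub_cancel, pow_succ]
  refine hom_ext ?_ ?_
  · change g₁ (g₂ a) = g₂ (g₁ a)
    rw [h₁a, h₂a, h₁a]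
  · change g₁ (g₂ b) = g₂ (g₁ b)
    refine mul_right_cancel (b := a ^ c) ?_
    have e₁ : g₁ (g₂ b) * a ^ c = g₁ (g₂ (b * a ^ c)) := by simp only [map_mul, map_pow, h₁a, h₂a]
    have e₂ : g₂ (g₁ b) * a ^ c = g₂ (g₁ (b * a ^ c)) := by simp only [map_mul, map_pow, h₁a, h₂a]
    rw [e₁, e₂, hu hq h₂a h₂b, hu hp h₁a h₁b, map_pow, map_pow, hu hq h₂a h₂b, hu hp h₁a h₁b,
      ← pow_mul, ← pow_mul, mul_comm]

end BinaryMorphism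

open BinaryMorphism in
theorem mainTheorem1
    (g₁ g₂ : BinaryMorphism.EndWord (Fin 2))
    (hg₁ : g₁ ∈ BinaryMorphism.Tri (Fin 2)) (hg₂ : g₂ ∈ BinaryMorphism.Tri (Fin 2))
    (s t p q γ₁ γ₂ δ₁ δ₂ : ℕ) (α β : ℕ → ℕ)
    (hs : 1 ≤ s) (ht : 1 ≤ t) (hp : 2 ≤ p) (hq : 2 ≤ q)
    (hg₁a : g₁ BinaryMorphism.a = BinaryMorphism.a ^ s)
    (hg₁b : g₁ BinaryMorphism.b = BinaryMorphism.blockWord p γ₁ γ₂ α)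
    (hg₂a : g₂ BinaryMorphism.a = BinaryMorphism.a ^ t)
    (hg₂b : g₂ BinaryMorphism.b = BinaryMorphism.blockWord q δ₁ δ₂ β)
    (hpq : BinaryMorphism.MultIndependent p q) :
    g₁ * g₂ = g₂ * g₁ ↔
      (g₁ BinaryMorphism.b ∈ Submonoid.powers BinaryMorphism.b ∧
        g₂ BinaryMorphism.b ∈ Submonoid.powers BinaryMorphism.b) ∨
      (g₁ BinaryMorphism.a = BinaryMorphism.a ∧ g₂ BinaryMorphism.a = BinaryMorphism.a ∧
        g₁ BinaryMorphism.b =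
          (BinaryMorphism.b * BinaryMorphism.a ^ α 1) ^ (p - 1) * BinaryMorphism.b ∧
        g₂ BinaryMorphism.b =
          (BinaryMorphism.b * BinaryMorphism.a ^ α 1) ^ (q - 1) * BinaryMorphism.b) := by
  constructor
  · intro hcomm
    obtain ⟨c, hγ, hδ, hα, hβ⟩ :=
      exponents_of_comm hs hp hq hg₁a hg₁b hg₂a hg₂b hpq hcomm
    -- Since `c ≤ s * c`, the equation `hγ` leaves no room for `γ₁` or `γ₂`; likewise for `hδ`.
    have hsc : c ≤ s * c := Nat.le_mul_of_pos_left c hs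
    have htc : c ≤ t * c := Nat.le_mul_of_pos_left c ht
    obtain ⟨rfl, rfl⟩ : γ₁ = 0 ∧ γ₂ = 0 := by omega
    obtain ⟨rfl, rfl⟩ : δ₁ = 0 ∧ δ₂ = 0 := by omega
    rw [blockWord_zero_zero_of_const (by omega) hα] at hg₁b
    rw [blockWord_zero_zero_of_const (by omega) hβ] at hg₂b
    rcases Nat.eq_zero_or_pos c with rfl | hc
    · refine Or.inl ⟨⟨p - 1 + 1, ?_⟩, ⟨q - 1 + 1, ?_⟩⟩
      · simp [hg₁b, pow_succ]
      · simp [hg₂b, pow_succ]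
    · have hs1 : s = 1 := Nat.eq_of_mul_eq_mul_right hc (by omega)
      have ht1 : t = 1 := Nat.eq_of_mul_eq_mul_right hc (by omega)
      rw [hα 1 one_pos hp]
      exact Or.inr ⟨by rw [hg₁a, hs1, pow_one], by rw [hg₂a, ht1, pow_one], hg₁b, hg₂b⟩
  · rintro (⟨h₁, h₂⟩ | ⟨h₁a, h₂a, h₁b, h₂b⟩)
    · exact comm_of_powers hg₁a hg₂a h₁ h₂
    · exact comm_of_periodic (by omega) (by omega) h₁a h₂a h₁b h₂b
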